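/- Let $\mathcal{A}$ be a finite alphabet and let $X \subseteq \mathcal{A}^{\mathbb{Z}}$ be a nonempty subshift (closed in the product topology and invariant under all translations) that is aperiodic, meaning that no $x \in X$ satisfies $x_{n+k} = x_n$ for all $n$ with some $k \neq 0$. Let $p_X(q)$ be the number of words of length $q$ occurring in elements of $X$, and for $x \in X$ let $p_x(q)$ be the number of words of length $q$ occurring in $x$. Suppose that there is a constant $d$ such that $p_X(q) \leq q + d$ for infinitely many $q$. Then: 1. there is a constant $c$ such that $p_X(q) = q + c$ for all sufficiently large $q$; 2. $X$ is quasi-Sturmian, in the sense that every $x \in X$ is: there is a constant $c_x$ such that $p_x(q) = q + c_x$ for all sufficiently large $q$; 3. $X$ admits no weakly mixing measure: there is no shift-invariant Borel probability measure $\mu$ on $X$ for which the shift $T$ is weakly mixing, i.e. for which $T \times T$ is ergodic with respect to $\mu \times \mu$. Consequently, if a nonempty aperiodic subshift $X$ admits a weakly mixing measure, then $p_X(q) - q \to \infty$ as $q \to \infty$; in particular $p_X(q) < q + f(q)$ cannot hold for infinitely many $q$ if $f$ is bounded. -/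

import Mathlib

open Filter MeasureTheory

namespace WordComplexity

variable {A : Type*}

/-- A word `w` of length `q` is a subword of the biinfinite sequence `x`. -/
def IsSubword {q : ℕ} (w : Fin q → A) (x : ℤ → A) : Prop :=
  ∃ k : ℤ, ∀ i : Fin q, w i = x ((i : ℤ) + k)

/-- The words of length `q` in the language of `X`. -/
def language (X : Set (ℤ → A)) (q : ℕ) : Set (Fin q → A) :=
  {w | ∃ x ∈ X, IsSubword w x}

/-- The word complexity function `p_X` of a set `X` of biinfinite sequences. (The alphabet is
finite wherever this is used, so the set that is counted is finite.) -/
noncomputable def complexity (X : Set (ℤ → A)) (q : ℕ) : ℕ :=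
  (language X q).ncard

/-- The word complexity function `p_x` of a single biinfinite word. -/
noncomputable def wordComplexity (x : ℤ → A) (q : ℕ) : ℕ :=
  {w : Fin q → A | IsSubword w x}.ncard

/-- A biinfinite word is periodic if it equals one of its nontrivial translates. -/
def IsPeriodicWord (x : ℤ → A) : Prop :=
  ∃ k : ℤ, k ≠ 0 ∧ ∀ n, x (n + k) = x n

/-- A set of biinfinite words is aperiodic if none of its elements is periodic. -/
def IsAperiodic (X : Set (ℤ → A)) : Prop :=
  ∀ x ∈ X, ¬ IsPeriodicWord x

/-- A word is quasi-Sturmian if `p_x(q) = q + c` for a constant `c` and all large `q`. -/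
def IsQuasiSturmian (x : ℤ → A) : Prop :=
  ∃ c : ℤ, ∀ᶠ q : ℕ in atTop, (wordComplexity x q : ℤ) = q + c

/-- A measure-preserving transformation is weakly mixing if `T × T` is ergodic for `μ × μ`. -/
def IsWeaklyMixing {Ω : Type*} [MeasurableSpace Ω] (T : Ω → Ω) (μ : Measure Ω) : Prop :=
  MeasurePreserving T μ μ ∧ Ergodic (Prod.map T T) (μ.prod μ)

/-- There is a shift-invariant probability measure, carried by `X`, for which the shift is weakly
mixing. The shift of Mathlib by `1` sends `x` to `n ↦ x (1 + n)`. -/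
def AdmitsWeaklyMixingMeasure [MeasurableSpace A] (X : Set (ℤ → A)) : Prop :=
  ∃ μ : Measure (ℤ → A), IsProbabilityMeasure μ ∧ μ Xᶜ = 0 ∧
    IsWeaklyMixing (SymbolicDynamics.FullShift.shift (1 : ℤ)) μ

end WordComplexity

/-! Without eventually periodic points, complexity rises by at least one at each step, so `p q - q`
is a nondecreasing integer sequence; boundedness along infinitely many `q` makes it eventually
constant. The same argument on the orbit of a point gives the quasi-Sturmian property.

Once the increment is exactly one, every long enough length has a single right special word, with
two extensions. Such a word of length `N` serves as a marker: recording which letter follows each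
successive occurrence codes every point by a binary sequence (`code`). The code inherits uniqueness
of right special words (`code_unique`) and lack of eventual periodicity (`code_not_periodic`), so it
is balanced by the classical palindrome argument for Sturmian sequences (`trueCount_le_succ`).

The gap after an occurrence depends only on the letter read there, so elapsed time is linear in the
two letter counts up to a bounded error (`exists_linear`). Balance per occurrence thus becomes
bounded discrepancy per unit of time for visits to a cylinder (`exists_letterVisits_le`).

Bounded discrepancy makes the centred indicator of the cylinder a coboundary. Modulo 1 its transfer
function is an eigenfunction, and weak mixing forces the measure of the cylinder to be 0 or 1
(`IsWeaklyMixing.measureReal_eq_zero_or_one`). Both are impossible, since every point meets the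
marker with each continuation. -/

namespace WordComplexity

/-! ### Repeated windows and periodicity -/

/-- If a window of length `q` reappears and every window in between determines its successor,
then the sequence is periodic from there on. -/
theorem periodic_of_window_eq {α : Type*} {s : ℕ → α} {q i j : ℕ} (hij : i < j)
    (hw : ∀ t < q, s (i + t) = s (j + t))
    (hdet : ∀ u, i ≤ u → u < j → ∀ v, (∀ t < q, s (u + t) = s (v + t)) → s (u + q) = s (v + q)) :
    ∀ n, s (i + n) = s (j + n) := by
  obtain ⟨p, rfl⟩ := Nat.exists_eq_add_of_lt hij
  -- Equality of windows and determinism are carried together: beyond `j`, a window is a copy of one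
  -- a period earlier and inherits its determinism.
  have key : ∀ n, (∀ t < q, s (i + n + t) = s (i + p + 1 + n + t)) ∧
      (∀ v, (∀ t < q, s (i + n + t) = s (v + t)) → s (i + n + q) = s (v + q)) := by
    intro n
    induction n using Nat.strong_induction_on with
    | _ n ih =>
      constructor
      · rcases n with _ | n
        · simpa using hw
        · obtain ⟨h1, h2⟩ := ih n (by omega)
          intro t ht
          rcases Nat.lt_or_ge (t + 1) q with h | h
          · have := h1 (t + 1) h
            convert this using 2 <;> ring
          · have hq : q = t + 1 := by omega
            have := h2 _ h1
            subst hq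
            convert this using 2 <;> ring
      · rcases Nat.lt_or_ge n (p + 1) with h | h
        · exact hdet _ (by omega) (by omega)
        · obtain ⟨k, rfl⟩ := Nat.exists_eq_add_of_le h
          obtain ⟨h1, h2⟩ := ih k (by omega)
          have e : i + (p + 1 + k) = i + p + 1 + k := by ring
          rw [e]
          intro v hv
          rw [← h2 _ h1]
          exact h2 v fun t ht => (h1 t ht).trans (hv t ht)
  intro n
  rcases Nat.lt_or_ge n q with h | h
  · exact hw n h
  · obtain ⟨k, rfl⟩ := Nat.exists_eq_add_of_le h
    have := (key k).2 _ (key k).1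
    convert this using 2 <;> ring

/-- A sequence whose first `m + 1` windows determine their successors and lie in a set of at most
`m` words is eventually periodic. -/
theorem exists_periodic_of_windows {α : Type*} {s : ℕ → α} {q m : ℕ} {W : Set (Fin q → α)}
    (hfin : W.Finite) (hcard : W.ncard ≤ m) (hW : ∀ u ≤ m, (fun t : Fin q => s (u + t)) ∈ W)
    (hdet : ∀ u ≤ m, ∀ v, (∀ t < q, s (u + t) = s (v + t)) → s (u + q) = s (v + q)) :
    ∃ i j, i < j ∧ ∀ n, s (i + n) = s (j + n) := by
  classical
  have hc : hfin.toFinset.card < (Finset.range (m + 1)).card := by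
    rw [← Set.ncard_eq_toFinset_card W hfin]
    simpa using Nat.lt_succ_of_le hcard
  obtain ⟨a, ha, b, hb, hne, hab⟩ := Finset.exists_ne_map_eq_of_card_lt_of_maps_to hc
    (f := fun u (t : Fin q) => s (u + t)) (by
      intro u hu
      simp only [Finset.coe_range, Set.mem_Iio] at hu
      simpa using hW u (by omega))
  simp only [Finset.mem_range] at ha hb
  have hab' : ∀ t < q, s (a + t) = s (b + t) := fun t ht => congrFun hab ⟨t, ht⟩
  rcases lt_or_gt_of_ne hne with h | h
  · exact ⟨a, b, h, periodic_of_window_eq h hab' fun u _ h2 => hdet u (by omega)⟩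
  · exact ⟨b, a, h, periodic_of_window_eq h (fun t ht => (hab' t ht).symm)
      fun u _ h2 => hdet u (by omega)⟩

/-! ### Balance of binary sequences with unique right special words -/

section Binary

variable {Y : Set (ℕ → Bool)}

/-- `a` and `a'` first differ at place `k`. -/
def SplitAt {α : Type*} (k : ℕ) (a a' : ℕ → α) : Prop :=
  (∀ i < k, a i = a' i) ∧ a k ≠ a' k

/-- The number of `true`s among the first `n` terms. -/
def trueCount (y : ℕ → Bool) (n : ℕ) : ℕ := ∑ i ∈ Finset.range n, (y i).toNat

/-- The prefixes of length `k` of the sequences in `Y`. -/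
def prefixes (Y : Set (ℕ → Bool)) (k : ℕ) : Set (Fin k → Bool) :=
  (fun y (i : Fin k) => y i) '' Y

/-- If no two sequences split at `k`, every window of length `k` determines its successor, and
pigeonhole gives eventual periodicity. -/
theorem exists_splitAt (hne : Y.Nonempty) (hS : ∀ y ∈ Y, ∀ k, (fun n => y (k + n)) ∈ Y)
    (hP : ∀ y ∈ Y, ∀ i j, i < j → ¬ ∀ n, y (i + n) = y (j + n)) (k : ℕ) :
    ∃ a ∈ Y, ∃ a' ∈ Y, SplitAt k a a' := by
  by_contra! hcon
  obtain ⟨y, hy⟩ := hne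
  obtain ⟨i, j, hij, h⟩ := exists_periodic_of_windows (s := y) (q := k)
    (W := Set.univ) Set.finite_univ le_rfl (fun _ _ => Set.mem_univ _) (by
      intro u _ v huv
      by_contra hne
      exact hcon _ (hS y hy u) _ (hS y hy v) ⟨huv, hne⟩)
  exact hP y hy i j hij h

/-- Only one word of each length has more than one extension, and over two letters it has two, so
each length adds at most one word. -/
theorem ncard_prefixes_le (hne : Y.Nonempty) (hS : ∀ y ∈ Y, ∀ k, (fun n => y (k + n)) ∈ Y)
    (hU : ∀ k, ∀ a ∈ Y, ∀ a' ∈ Y, ∀ b ∈ Y, ∀ b' ∈ Y, SplitAt k a a' → SplitAt k b b' →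
      ∀ i < k, a i = b i)
    (hP : ∀ y ∈ Y, ∀ i j, i < j → ¬ ∀ n, y (i + n) = y (j + n)) (k : ℕ) :
    (prefixes Y k).ncard ≤ k + 1 := by
  induction k with
  | zero => exact Set.ncard_le_one_of_subsingleton _
  | succ k ih =>
    obtain ⟨b, hb, b', hb', hbb⟩ := exists_splitAt hne hS hP k
    -- With one extension of the right special word discarded, truncation is injective.
    have h1 : (prefixes Y (k + 1) \ {fun i : Fin (k + 1) => b i}).ncard ≤ (prefixes Y k).ncard := by
      refine Set.ncard_le_ncard_of_injOn (fun w i => w i.castSucc) ?_ ?_ (Set.toFinite _)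
      · rintro _ ⟨⟨y, hy, rfl⟩, -⟩
        exact ⟨y, hy, rfl⟩
      · rintro _ ⟨⟨y, hy, rfl⟩, h⟩ _ ⟨⟨y', hy', rfl⟩, h'⟩ heq
        have hag : ∀ i < k, y i = y' i := fun i hi => congrFun heq ⟨i, hi⟩
        by_cases hk : y k = y' k
        · funext i
          rcases Nat.lt_or_ge i k with hi | hi
          · exact hag i hi
          · have : (i : ℕ) = k := by omega
            simp only [this, hk]
        · exfalso
          have e1 := hU k y hy y' hy' b hb b' hb' ⟨hag, hk⟩ hbb
          have aux : ∀ z : ℕ → Bool, (∀ i < k, z i = b i) → z k = b k →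
              (fun i : Fin (k + 1) => z i) ∈ ({fun i : Fin (k + 1) => b i} : Set (Fin (k + 1) → Bool)) := by
            intro z hz hzk
            refine funext fun i => ?_
            rcases Nat.lt_or_ge i k with hi | hi
            · exact hz i hi
            · have : (i : ℕ) = k := by omega
              simp only [this, hzk]
          by_cases hyb : y k = b k
          · exact h (aux y e1 hyb)
          · refine h' (aux y' (fun i hi => (hag i hi).symm.trans (e1 i hi)) ?_)
            revert hk hyb
            cases y k <;> cases y' k <;> cases b k <;> simp
    have h2 := Set.ncard_le_ncard_sdiff_add_ncard (prefixes Y (k + 1)) {fun i : Fin (k + 1) => b i}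
      (Set.toFinite _)
    rw [Set.ncard_singleton] at h2
    omega

theorem trueCount_succ (y : ℕ → Bool) (n : ℕ) :
    trueCount y (n + 1) = trueCount y n + (y n).toNat := Finset.sum_range_succ _ _

theorem trueCount_add (y : ℕ → Bool) (m n : ℕ) :
    trueCount y (m + n) = trueCount y m + trueCount (fun i => y (m + i)) n :=
  Finset.sum_range_add _ _ _

theorem trueCount_le (y : ℕ → Bool) (n : ℕ) : trueCount y n ≤ n := by
  induction n with
  | zero => simp [trueCount]
  | succ n ih => rw [trueCount_succ]; have := (y n).toNat_le; omega

/-- A shift-closed set of binary sequences, none of them eventually periodic, with only one right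
special word of each length is balanced. -/
theorem trueCount_le_succ (hS : ∀ y ∈ Y, ∀ k, (fun n => y (k + n)) ∈ Y)
    (hU : ∀ k, ∀ a ∈ Y, ∀ a' ∈ Y, ∀ b ∈ Y, ∀ b' ∈ Y, SplitAt k a a' → SplitAt k b b' →
      ∀ i < k, a i = b i)
    (hP : ∀ y ∈ Y, ∀ i j, i < j → ¬ ∀ n, y (i + n) = y (j + n)) :
    ∀ n, ∀ y ∈ Y, ∀ y' ∈ Y, trueCount y n ≤ trueCount y' n + 1 := by
  intro n
  induction n using Nat.strong_induction_on with
  | _ n ih =>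
  intro y hy y' hy'
  by_contra! hbad
  have hne : Y.Nonempty := ⟨y, hy⟩
  -- The two prefixes differ exactly at both ends.
  have hD : ∀ i, 0 < i → i < n → trueCount y i = trueCount y' i + 1 := by
    intro i h0 hi
    obtain ⟨k, rfl⟩ := Nat.exists_eq_add_of_lt hi
    have h1 := ih i hi y hy y' hy'
    have h2 := ih (k + 1) (by omega) _ (hS y hy i) _ (hS y' hy' i)
    rw [add_assoc, trueCount_add y, trueCount_add y'] at hbad
    omega
  obtain ⟨m, rfl⟩ : ∃ m, n = m + 2 := by
    rcases n with _ | _ | m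
    · simp [trueCount] at hbad
    · have := trueCount_le y 1
      simp only [zero_add] at hbad
      omega
    · exact ⟨m, rfl⟩
  have h0 : y 0 = true ∧ y' 0 = false := by
    have := hD 1 (by omega) (by omega)
    simp only [trueCount, Finset.range_one, Finset.sum_singleton] at this
    revert this
    cases y 0 <;> cases y' 0 <;> simp
  have hmid : ∀ i, i < m → y (i + 1) = y' (i + 1) := by
    intro i hi
    have a1 := hD (i + 1) (by omega) (by omega)
    have a2 := hD (i + 1 + 1) (by omega) (by omega)
    rw [trueCount_succ y, trueCount_succ y'] at a2
    have : (y (i + 1)).toNat = (y' (i + 1)).toNat := by omega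
    revert this
    cases y (i + 1) <;> cases y' (i + 1) <;> simp
  have hlast : y (m + 1) = true ∧ y' (m + 1) = false := by
    have a1 := hD (m + 1) (by omega) (by omega)
    rw [show m + 2 = m + 1 + 1 by rfl, trueCount_succ y, trueCount_succ y'] at hbad
    revert hbad
    cases y (m + 1) <;> cases y' (m + 1) <;> simp <;> omega
  -- The common middle word is a palindrome.
  have hpal : ∀ i, i < m → y (i + 1) = y (m - i) := by
    intro i
    induction i using Nat.strong_induction_on with
    | _ i ihi =>
    intro hi
    -- The two windows of length `i + 2` have mirrored interiors, so their counts differ only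
    -- through the four end letters. A first failure of the palindrome property at `i` would give a
    -- difference of two, against balance at the shorter length `i + 2`.
    have hsum : ∀ z z' : ℕ → Bool, (∀ t < i, z (t + 1) = z' (m - t)) →
        trueCount z (i + 2) + (z' (m - i)).toNat + (z' (m + 1)).toNat =
          trueCount (fun t => z' (m - i + t)) (i + 2) + (z 0).toNat + (z (i + 1)).toNat := by
      intro z z' hz
      have e1 : trueCount z (i + 2) = (z 0).toNat + (z (i + 1)).toNat +
          ∑ t ∈ Finset.range i, (z (t + 1)).toNat := by
        rw [trueCount, Finset.sum_range_succ, Finset.sum_range_succ']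
        ring
      have e2 : trueCount (fun t => z' (m - i + t)) (i + 2) = (z' (m - i)).toNat +
          (z' (m + 1)).toNat + ∑ t ∈ Finset.range i, (z' (m - i + (t + 1))).toNat := by
        rw [trueCount, Finset.sum_range_succ, Finset.sum_range_succ',
          show m - i + (i + 1) = m + 1 by omega]
        simp only [add_zero]
        ring
      have e3 : ∑ t ∈ Finset.range i, (z (t + 1)).toNat =
          ∑ t ∈ Finset.range i, (z' (m - i + (t + 1))).toNat := by
        rw [← Finset.sum_range_reflect (fun t => (z' (m - i + (t + 1))).toNat)]
        refine Finset.sum_congr rfl fun t ht => ?_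
        rw [Finset.mem_range] at ht
        rw [hz t ht, show m - i + (i - 1 - t + 1) = m - t by omega]
      omega
    have hmi : y (m - i) = y' (m - i) := by
      have := hmid (m - i - 1) (by omega)
      rwa [show m - i - 1 + 1 = m - i by omega] at this
    have b1 := ih (i + 2) (by omega) y hy _ (hS y' hy' (m - i))
    have b2 := ih (i + 2) (by omega) _ (hS y hy (m - i)) y' hy'
    have c1 := hsum y y' (fun t ht => by
      rw [ihi t ht (by omega)]
      have := hmid (m - t - 1) (by omega)
      rwa [show m - t - 1 + 1 = m - t by omega] at this)
    have c2 := hsum y' y (fun t ht => by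
      rw [← ihi t ht (by omega), hmid t (by omega)])
    rw [← hmi, h0.1, hlast.2] at c1
    rw [← hmid i hi, h0.2, hlast.1] at c2
    revert b1 b2 c1 c2
    cases y (i + 1) <;> cases y (m - i) <;> simp <;> omega
  -- The right special word of length `m + 1`, and a sequence that avoids it for long.
  obtain ⟨b, hb, b', hb', hbb⟩ := exists_splitAt hne hS hP (m + 1)
  have hbm : ∀ i < m, b (i + 1) = y (i + 1) := by
    intro i hi
    have := hU m _ (hS b hb 1) _ (hS b' hb' 1) _ (hS y hy 1) _ (hS y' hy' 1)
      ⟨fun t ht => hbb.1 _ (by omega), by simpa [add_comm] using hbb.2⟩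
      ⟨fun t ht => by simpa [add_comm] using hmid t ht, by
        simp only [add_comm 1 m, hlast.1, hlast.2]; simp⟩ i hi
    simpa [add_comm] using this
  -- The right special word is `b 0` followed by the common middle word; `z` is whichever of `y`,
  -- `y'` has the opposite letter at both ends.
  obtain ⟨z, hz, hz0, hzm, hzl⟩ : ∃ z ∈ Y, z 0 ≠ b 0 ∧ (∀ i < m, z (i + 1) = y (i + 1)) ∧
      z (m + 1) ≠ b 0 := by
    rcases hb0 : b 0 with _ | _
    · exact ⟨y, hy, by simp [h0.1], fun _ _ => rfl, by simp [hlast.1]⟩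
    · exact ⟨y', hy', by simp [h0.2], fun i hi => (hmid i hi).symm, by simp [hlast.2]⟩
  have havoid : ∀ u ≤ m + 1, ¬ ∀ t < m + 1, z (u + t) = b t := by
    intro u hu hub
    rcases Nat.eq_zero_or_pos u with rfl | hu0
    · exact hz0 (by simpa using hub 0 (by omega))
    rcases Nat.lt_or_ge m u with hmu | hmu
    · have : u = m + 1 := by omega
      subst this
      exact hzl (by simpa using hub 0 (by omega))
    · obtain ⟨k, rfl⟩ : ∃ k, u = k + 1 := ⟨u - 1, by omega⟩
      have d1 : z (k + 1) = b 0 := by simpa using hub 0 (by omega)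
      have d2 := hub (m - k) (by omega)
      rw [show k + 1 + (m - k) = m + 1 by omega] at d2
      have d3 := hbm (m - k - 1) (by omega)
      rw [show m - k - 1 + 1 = m - k by omega] at d3
      -- An occurrence starting inside the middle word would, by the palindrome property, place at
      -- `m + 1` the letter it starts with, namely `b 0`.
      exact hzl (by rw [d2, d3, ← hpal k (by omega), ← hzm k (by omega), d1])
  -- At most `m + 1` words remain for the `m + 2` windows of `z` starting at `0, …, m + 1`, and each
  -- of them determines its successor.
  have hcard : (prefixes Y (m + 1) \ {fun i : Fin (m + 1) => b i}).ncard ≤ m + 1 := by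
    have h1 := ncard_prefixes_le hne hS hU hP (m + 1)
    have h2 := Set.ncard_sdiff_singleton_add_one (s := prefixes Y (m + 1))
      (a := fun i : Fin (m + 1) => b i) ⟨b, hb, rfl⟩ (Set.toFinite _)
    omega
  obtain ⟨i, j, hij, h⟩ := exists_periodic_of_windows (s := z) (q := m + 1)
    (Set.toFinite _) hcard
    (fun u hu => ⟨⟨_, hS z hz u, rfl⟩, fun heq => havoid u hu fun t ht =>
      congrFun (Set.mem_singleton_iff.1 heq) ⟨t, ht⟩⟩)
    (by
      intro u hu v huv
      by_contra hne
      exact havoid u hu (hU (m + 1) _ (hS z hz u) _ (hS z hz v) b hb b' hb' ⟨huv, hne⟩ hbb))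
  exact hP z hz i j hij h

end Binary

/-! ### Complexity growth and right special words -/

open SymbolicDynamics.FullShift (shift Subshift cylinder)

/-- If the image of a finite set has at most one element less than the set, then at most one pair
of points is identified. -/
theorem pair_eq_of_ncard_le_ncard_image_succ {α β : Type*} {S : Set α} {f : α → β} (hS : S.Finite)
    (hc : S.ncard ≤ (f '' S).ncard + 1) {s s' t t' : α} (hs : s ∈ S) (hs' : s' ∈ S) (ht : t ∈ S)
    (ht' : t' ∈ S) (hne : s ≠ s') (hf : f s = f s') (hne' : t ≠ t') (hf' : f t = f t') :
    (t = s ∧ t' = s') ∨ (t = s' ∧ t' = s) := by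
  have aux : ∀ a ∈ S, ∀ b ∈ S, a ≠ b → f a = f b → Set.InjOn f (S \ {a}) := by
    intro a ha b hb hab hfab
    have h1 : f '' (S \ {a}) = f '' S := by
      refine Set.Subset.antisymm (Set.image_mono Set.sdiff_subset) ?_
      rintro _ ⟨x, hx, rfl⟩
      by_cases hxa : x = a
      · exact ⟨b, ⟨hb, fun h => hab h.symm⟩, by rw [hxa, hfab]⟩
      · exact ⟨x, ⟨hx, hxa⟩, rfl⟩
    have h2 := Set.ncard_sdiff_singleton_add_one ha hS
    have h3 := Set.ncard_image_le (f := f) (hS.sdiff (t := {a}))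
    exact Set.injOn_of_ncard_image_eq (by rw [h1] at h3 ⊢; omega) hS.sdiff
  have h1 := aux s hs s' hs' hne hf
  have h2 := aux s' hs' s hs hne.symm hf.symm
  have h3 : t = s ∨ t' = s := by
    by_contra! h
    exact hne' (h1 ⟨ht, h.1⟩ ⟨ht', h.2⟩ hf')
  have h4 : t = s' ∨ t' = s' := by
    by_contra! h
    exact hne' (h2 ⟨ht, h.1⟩ ⟨ht', h.2⟩ hf')
  grind

variable {A : Type*} {X : Set (ℤ → A)}

theorem language_eq_image (hT : ∀ k : ℤ, ∀ x ∈ X, shift k x ∈ X) (q : ℕ) :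
    language X q = (fun (x : ℤ → A) (i : Fin q) => x i) '' X := by
  ext w
  constructor
  · rintro ⟨x, hx, k, hk⟩
    refine ⟨_, hT k x hx, funext fun i => ?_⟩
    change x (k + i) = w i
    rw [hk i, add_comm]
  · rintro ⟨x, hx, rfl⟩
    exact ⟨x, hx, 0, fun i => by simp⟩

theorem language_eq_image_succ (hT : ∀ k : ℤ, ∀ x ∈ X, shift k x ∈ X) (q : ℕ) :
    language X q = (fun (w : Fin (q + 1) → A) (i : Fin q) => w i.castSucc) ''
      language X (q + 1) := by
  rw [language_eq_image hT, language_eq_image hT, Set.image_image]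
  rfl

/-- A shift-invariant set without eventually periodic elements has strictly increasing
complexity. -/
theorem complexity_lt_complexity_succ [Finite A] (hne : X.Nonempty)
    (hT : ∀ k : ℤ, ∀ x ∈ X, shift k x ∈ X)
    (hP : ∀ x ∈ X, ∀ i j : ℕ, i < j → ¬ ∀ n : ℕ, x (i + n) = x (j + n)) (q : ℕ) :
    complexity X q < complexity X (q + 1) := by
  by_contra! hle
  have hinj : Set.InjOn (fun (w : Fin (q + 1) → A) (i : Fin q) => w i.castSucc)
      (language X (q + 1)) := by
    refine Set.injOn_of_ncard_image_eq ?_ (Set.toFinite _)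
    have := Set.ncard_image_le (f := fun (w : Fin (q + 1) → A) (i : Fin q) => w i.castSucc)
      (Set.toFinite (language X (q + 1)))
    rw [← language_eq_image_succ hT] at this ⊢
    exact le_antisymm this hle
  obtain ⟨x, hx⟩ := hne
  obtain ⟨i, j, hij, h⟩ := exists_periodic_of_windows (s := fun n : ℕ => x n) (q := q)
    (W := Set.univ) Set.finite_univ le_rfl (fun _ _ => Set.mem_univ _) (by
      intro u _ v huv
      rw [language_eq_image hT] at hinj
      have := hinj ⟨_, hT u x hx, rfl⟩ ⟨_, hT v x hx, rfl⟩
        (funext fun i => by simpa using huv i i.2)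
      simpa using congrFun this (Fin.last q))
  exact hP x hx i j hij fun n => by simpa using h n

/-- Deleting the last letter maps words of length `q + 1` onto words of length `q`, and the
increment leaves room for only one collapsed pair. Words end at place 0, so that shorter ones are
suffixes of longer ones. -/
theorem eq_or_eq_of_complexity_succ_le [Finite A] (hT : ∀ k : ℤ, ∀ x ∈ X, shift k x ∈ X) {q : ℕ}
    (hq : complexity X (q + 1) ≤ complexity X q + 1) {x y x' y' : ℤ → A}
    (hx : x ∈ X) (hy : y ∈ X) (hx' : x' ∈ X) (hy' : y' ∈ X)
    (h : ∀ i : ℤ, -q ≤ i → i < 0 → x i = y i) (h0 : x 0 ≠ y 0)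
    (h' : ∀ i : ℤ, -q ≤ i → i < 0 → x' i = y' i) (h0' : x' 0 ≠ y' 0) :
    (∀ i : ℤ, -q ≤ i → i ≤ 0 → x' i = x i ∧ y' i = y i) ∨
      (∀ i : ℤ, -q ≤ i → i ≤ 0 → x' i = y i ∧ y' i = x i) := by
  unfold complexity at hq
  rw [language_eq_image_succ hT q, language_eq_image hT] at hq
  have mem : ∀ z ∈ X, (fun i : Fin (q + 1) => z (-q + i)) ∈
      (fun (x : ℤ → A) (i : Fin (q + 1)) => x i) '' X := fun z hz => ⟨_, hT (-q) z hz, rfl⟩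
  have hn : ∀ z w : ℤ → A, z 0 ≠ w 0 →
      (fun i : Fin (q + 1) => z (-q + i)) ≠ (fun i : Fin (q + 1) => w (-q + i)) := by
    intro z w hzw heq
    exact hzw (by simpa using congrFun heq (Fin.last q))
  have hr : ∀ z w : ℤ → A, (∀ i : ℤ, -q ≤ i → i < 0 → z i = w i) →
      (fun i : Fin q => z (-q + (i.castSucc : ℕ))) = fun i : Fin q => w (-q + (i.castSucc : ℕ)) := by
    intro z w hzw
    funext i
    have := i.2
    exact hzw _ (by simp) (by simp)
  have hb : ∀ z w : ℤ → A, (fun i : Fin (q + 1) => z (-q + i)) =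
      (fun i : Fin (q + 1) => w (-q + i)) → ∀ i : ℤ, -q ≤ i → i ≤ 0 → z i = w i := by
    intro z w hzw i hi hi0
    obtain ⟨k, hk⟩ := Int.eq_ofNat_of_zero_le (show 0 ≤ i + q by omega)
    have := congrFun hzw ⟨k, by omega⟩
    simpa [← hk] using this
  rcases pair_eq_of_ncard_le_ncard_image_succ (Set.toFinite _) hq (mem x hx) (mem y hy)
    (mem x' hx') (mem y' hy') (hn x y h0) (hr x y h) (hn x' y' h0') (hr x' y' h') with
    ⟨h1, h2⟩ | ⟨h1, h2⟩
  · exact Or.inl fun i hi hi0 => ⟨hb _ _ h1 i hi hi0, hb _ _ h2 i hi hi0⟩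
  · exact Or.inr fun i hi hi0 => ⟨hb _ _ h1 i hi hi0, hb _ _ h2 i hi hi0⟩

/-- An integer-valued sequence that increases by at least one at each step and is infinitely often
at most `q + d` is eventually `q + c`. -/
theorem eventually_eq_add_of_infinite {p : ℕ → ℕ} (hp : ∀ q, p q < p (q + 1)) {d : ℤ}
    (hd : {q : ℕ | (p q : ℤ) ≤ q + d}.Infinite) : ∃ c : ℤ, ∀ᶠ q : ℕ in atTop, (p q : ℤ) = q + c := by
  have hmono : Monotone fun q : ℕ => (p q : ℤ) - q :=
    monotone_nat_of_le_succ fun q => by have := hp q; push_cast; omega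
  have hbdd : ∀ q : ℕ, (p q : ℤ) - q ≤ d := by
    intro q
    obtain ⟨r, hr, hqr⟩ := hd.exists_gt q
    have h1 := hmono hqr.le
    simp only [Set.mem_ofPred_eq] at hr h1
    omega
  obtain ⟨c, ⟨q₀, hq₀⟩, hmax⟩ := Int.exists_greatest_of_bdd
    (P := fun c => ∃ q : ℕ, (p q : ℤ) - q = c) ⟨d, fun c ⟨q, hq⟩ => hq ▸ hbdd q⟩ ⟨_, 0, rfl⟩
  refine ⟨c, eventually_atTop.2 ⟨q₀, fun q hq => ?_⟩⟩
  have h1 := hmono hq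
  have h2 := hmax _ ⟨q, rfl⟩
  simp only at h1
  omega

/-- The orbit of a point under the shift has the language of that point. -/
theorem complexity_range_shift (x : ℤ → A) (q : ℕ) :
    complexity (Set.range fun k : ℤ => shift k x) q = wordComplexity x q := by
  unfold complexity wordComplexity
  congr 1
  ext w
  constructor
  · rintro ⟨_, ⟨l, rfl⟩, k, hk⟩
    refine ⟨l + k, fun i => ?_⟩
    rw [hk i]
    change x (l + (i + k)) = x (i + (l + k))
    congr 1
    ring
  · intro h
    exact ⟨x, ⟨0, by simp⟩, h⟩

theorem wordComplexity_le_complexity [Finite A] {x : ℤ → A} (hx : x ∈ X) (q : ℕ) :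
    wordComplexity x q ≤ complexity X q :=
  Set.ncard_le_ncard (fun _ hw => ⟨x, hx, hw⟩) (Set.toFinite _)

/-- An aperiodic subshift has no eventually periodic elements. -/
theorem IsAperiodic.not_eventually_periodic [TopologicalSpace A] [DiscreteTopology A]
    {X : Subshift A ℤ} (hap : IsAperiodic X.carrier) {x : ℤ → A} (hx : x ∈ X.carrier) {i j : ℕ}
    (hij : i < j) : ¬ ∀ n : ℕ, x (i + n) = x (j + n) := by
  intro h
  obtain ⟨p, rfl⟩ := Nat.exists_eq_add_of_lt hij
  have hstep : ∀ m : ℤ, i ≤ m → x (m + (p + 1)) = x m := by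
    intro m hm
    obtain ⟨k, hk⟩ := Int.eq_ofNat_of_zero_le (show 0 ≤ m - i by omega)
    have := h k
    rw [show m = i + k by omega, this]
    push_cast
    congr 1
    ring
  -- Translates of `x` by multiples of `p + 1` stabilise at each place; `z` is their limit. After
  -- `n.natAbs + i` periods the place `n` lies in the periodic part.
  set z : ℤ → A := fun n => x (n + (p + 1) * (n.natAbs + i : ℕ)) with hz
  have hzk : ∀ n : ℤ, ∀ k : ℕ, n.natAbs + i ≤ k → x (n + (p + 1) * k) = z n := by
    intro n k hk
    induction k, hk using Nat.le_induction with
    | base => rfl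
    | succ k hk ih =>
      rw [← ih, ← hstep (n + (p + 1) * k)]
      · push_cast
        congr 1
        ring
      · have : (k : ℤ) ≤ (p + 1) * k := by nlinarith
        omega
  have hmem : z ∈ X.carrier := by
    refine X.isClosed.mem_of_tendsto (b := atTop)
      (f := fun k : ℕ => shift ((p + 1) * k : ℤ) x) ?_ (Eventually.of_forall fun k => X.mapsTo _ hx)
    refine tendsto_pi_nhds.2 fun n => tendsto_const_nhds.congr' ?_
    filter_upwards [eventually_ge_atTop (n.natAbs + i)] with k hk
    rw [← hzk n k hk, SymbolicDynamics.FullShift.shift_apply, add_comm]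
  refine hap z hmem ⟨p + 1, by omega, fun n => ?_⟩
  set k := (n + (p + 1)).natAbs + n.natAbs + i
  rw [← hzk (n + (p + 1)) k (by omega), ← hzk n (k + 1) (by omega)]
  push_cast
  congr 1
  ring

/-! ### Coding by the letters that follow a marker -/

section Coding

open scoped Classical

variable {A : Type*}

/-- The word `w` on `[-N, 0)` occurs in `x` just before the place `u`. -/
def Occurs (N : ℕ) (w x : ℤ → A) (u : ℕ) : Prop :=
  ∀ i : ℤ, -N ≤ i → i < 0 → x (u + i) = w i

/-- The number of places before `n` at which `w` occurs. -/
noncomputable def visits (N : ℕ) (w x : ℤ → A) (n : ℕ) : ℕ := Nat.count (Occurs N w x) n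

/-- The number of places before `n` at which `w` occurs and is followed by the letter `w 0`. -/
noncomputable def letterVisits (N : ℕ) (w x : ℤ → A) (n : ℕ) : ℕ :=
  Nat.count (fun u => Occurs N w x u ∧ x u = w 0) n

/-- Which occurrences of `w` in `x` are followed by the letter `w 0`. -/
noncomputable def code (N : ℕ) (w x : ℤ → A) (j : ℕ) : Bool :=
  decide (x (Nat.nth (Occurs N w x) j) = w 0)

/-- The words `w` and `w'` on `[-N, 0]` are two extensions of a right special word, and from the
length `N` on right special words are unique and have two extensions. -/
structure IsMarker (X : Set (ℤ → A)) (N : ℕ) (w w' : ℤ → A) : Prop where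
  mem : w ∈ X
  mem' : w' ∈ X
  shift_mem : ∀ k : ℤ, ∀ x ∈ X, shift k x ∈ X
  not_periodic : ∀ x ∈ X, ∀ i j : ℕ, i < j → ¬ ∀ n : ℕ, x (i + n) = x (j + n)
  agree : ∀ i : ℤ, -N ≤ i → i < 0 → w i = w' i
  ne : w 0 ≠ w' 0
  unique : ∀ q : ℕ, N ≤ q → ∀ x ∈ X, ∀ y ∈ X, ∀ x' ∈ X, ∀ y' ∈ X,
    (∀ i : ℤ, -q ≤ i → i < 0 → x i = y i) → x 0 ≠ y 0 →
    (∀ i : ℤ, -q ≤ i → i < 0 → x' i = y' i) → x' 0 ≠ y' 0 →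
    (∀ i : ℤ, -q ≤ i → i ≤ 0 → x' i = x i ∧ y' i = y i) ∨
      (∀ i : ℤ, -q ≤ i → i ≤ 0 → x' i = y i ∧ y' i = x i)

variable {X : Set (ℤ → A)} {N : ℕ} {w w' x x' : ℤ → A} {n : ℕ}

theorem occurs_shift (a u : ℕ) : Occurs N w (shift (a : ℤ) x) u ↔ Occurs N w x (a + u) := by
  unfold Occurs
  refine forall_congr' fun i => ?_
  rw [SymbolicDynamics.FullShift.shift_apply]
  push_cast
  rw [add_assoc]

theorem occurs_congr (h : ∀ i : ℤ, -N ≤ i → i < n → x i = x' i) {u : ℕ} (hu : u ≤ n) :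
    Occurs N w x u ↔ Occurs N w x' u := by
  refine forall_congr' fun i => forall_congr' fun hi => forall_congr' fun hi0 => ?_
  rw [h _ (by omega) (by omega)]

theorem count_congr {p q : ℕ → Prop} [DecidablePred p] [DecidablePred q] {n : ℕ}
    (h : ∀ u < n, p u ↔ q u) : Nat.count p n = Nat.count q n := by
  induction n with
  | zero => simp
  | succ n ih =>
    rw [Nat.count_succ, Nat.count_succ, ih fun u hu => h u (by omega)]
    simp [h n (by omega)]

theorem visits_congr (h : ∀ i : ℤ, -N ≤ i → i < n → x i = x' i) :
    visits N w x n = visits N w x' n :=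
  count_congr fun _ hu => occurs_congr h hu.le

theorem visits_add (a n : ℕ) :
    visits N w x (a + n) = visits N w x a + visits N w (shift (a : ℤ) x) n := by
  unfold visits
  rw [Nat.count_add]
  congr 1
  exact count_congr fun u _ => (occurs_shift a u).symm

theorem visits_succ_of_occurs (h : Occurs N w x n) : visits N w x (n + 1) = visits N w x n + 1 := by
  simp [visits, Nat.count_succ, h]

theorem visits_succ_of_not_occurs (h : ¬ Occurs N w x n) :
    visits N w x (n + 1) = visits N w x n := by
  simp [visits, Nat.count_succ, h]

theorem code_visits (h : Occurs N w x n) :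
    code N w x (visits N w x n) = true ↔ x n = w 0 := by
  unfold code visits
  rw [Nat.nth_count h]
  simp

theorem exists_visits_eq (hinf : (Set.ofPred (Occurs N w x)).Infinite) (j : ℕ) :
    ∃ u, Occurs N w x u ∧ visits N w x u = j :=
  ⟨_, Nat.nth_mem_of_infinite hinf j, Nat.count_nth_of_infinite hinf j⟩

theorem exists_visits_eq_of_lt {j : ℕ} (hj : j < visits N w x n) :
    ∃ u < n, Occurs N w x u ∧ visits N w x u = j := by
  have h : ∀ hf : (Set.ofPred (Occurs N w x)).Finite, j < hf.toFinset.card := fun hf =>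
    hj.trans_le (Nat.count_le_card hf n)
  exact ⟨_, Nat.nth_lt_of_lt_count hj, Nat.nth_mem _ h, Nat.count_nth h⟩

theorem code_congr (h : ∀ i : ℤ, -N ≤ i → i < n → x i = x' i) {j : ℕ} (hj : j < visits N w x n) :
    code N w x j = code N w x' j := by
  obtain ⟨u, hu, ho, rfl⟩ := exists_visits_eq_of_lt hj
  rw [Bool.eq_iff_iff, code_visits ho, visits_congr (n := u) (x' := x')
    fun i hi hin => h i hi (by omega), code_visits ((occurs_congr h hu.le).1 ho),
    h u (by omega) (by omega)]

namespace IsMarker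

variable (hX : IsMarker X N w w')
include hX

theorem occurs_of_ne (hx : x ∈ X) (hx' : x' ∈ X)
    (h : ∀ i : ℤ, n - N ≤ i → i < n → x i = x' i) (hne : x n ≠ x' n) :
    Occurs N w x n ∧ ((x n = w 0 ∧ x' n = w' 0) ∨ (x n = w' 0 ∧ x' n = w 0)) := by
  have := hX.unique N le_rfl w hX.mem w' hX.mem' _ (hX.shift_mem n x hx) _ (hX.shift_mem n x' hx')
    hX.agree hX.ne (fun i hi hi0 => h _ (by omega) (by omega)) (by simpa using hne)
  simp only [SymbolicDynamics.FullShift.shift_apply] at this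
  rcases this with this | this
  · exact ⟨fun i hi hi0 => (this i hi hi0.le).1, Or.inl (by simpa using this 0 (by simp) le_rfl)⟩
  · exact ⟨fun i hi hi0 => (this i hi hi0.le).1.trans (hX.agree i hi hi0).symm,
      Or.inr (by simpa using this 0 (by simp) le_rfl)⟩

theorem letter_of_occurs (hx : x ∈ X) (ho : Occurs N w x n) (hne : x n ≠ w 0) : x n = w' 0 := by
  have hs := hX.shift_mem (-n) w hX.mem
  have := hX.occurs_of_ne (n := n) hx hs (fun i hi hin => by
    have := ho (i - n) (by omega) (by omega)
    simp only [SymbolicDynamics.FullShift.shift_apply]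
    rw [show -(n : ℤ) + i = i - n by ring, ← this]
    congr 1
    ring) (by simpa using hne)
  rcases this.2 with h | h
  · exact absurd h.1 hne
  · exact h.1

/-- Occurrences of the marker have bounded gaps. -/
theorem exists_occurs_le [Finite A] : ∃ K, ∀ x ∈ X, ∃ u ≤ K, Occurs N w x u := by
  -- The bound is the pigeonhole number: windows before the first occurrence of the marker determine
  -- their successors, so too many of them would force periodicity.
  refine ⟨(Set.univ : Set (Fin N → A)).ncard, fun x hx => ?_⟩
  by_contra! hcon
  have hy := hX.shift_mem (-N) x hx
  obtain ⟨i, j, hij, h⟩ := exists_periodic_of_windows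
    (s := fun n : ℕ => shift (-N : ℤ) x n) (q := N) (W := Set.univ) Set.finite_univ le_rfl
    (fun _ _ => Set.mem_univ _) (by
      intro u hu v huv
      by_contra hne
      refine hcon u hu (hX.occurs_of_ne (n := u) hx (hX.shift_mem ((v : ℤ) - u) x hx) ?_ ?_).1
      · intro i hi hin
        obtain ⟨t, ht⟩ := Int.eq_ofNat_of_zero_le (show 0 ≤ i + N - u by omega)
        have := huv t (by omega)
        simp only [SymbolicDynamics.FullShift.shift_apply] at this ⊢
        push_cast at this
        rw [show i = -N + ((u : ℤ) + t) by omega, this]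
        congr 1
        ring
      · simp only [SymbolicDynamics.FullShift.shift_apply] at hne ⊢
        push_cast at hne
        rwa [show -(N : ℤ) + (u + N) = u by ring, show -(N : ℤ) + (v + N) = v - u + u by ring]
          at hne)
  exact hX.not_periodic _ hy i j hij fun n => by simpa using h n

theorem infinite_occurs [Finite A] (hx : x ∈ X) : (Set.ofPred (Occurs N w x)).Infinite := by
  obtain ⟨K, hK⟩ := hX.exists_occurs_le
  refine Set.infinite_of_not_bddAbove fun ⟨a, ha⟩ => ?_
  obtain ⟨u, -, hu⟩ := hK _ (hX.shift_mem (a + 1 : ℕ) x hx)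
  have := ha ((occurs_shift (a + 1) u).1 hu)
  omega

theorem code_shift [Finite A] (hx : x ∈ X) (a j : ℕ) :
    code N w (shift (a : ℤ) x) j = code N w x (visits N w x a + j) := by
  obtain ⟨u, hu, rfl⟩ := exists_visits_eq (hX.infinite_occurs (hX.shift_mem a x hx)) j
  rw [← visits_add, Bool.eq_iff_iff, code_visits hu, code_visits ((occurs_shift a u).1 hu)]
  simp

/-- The first place where two points differ is an occurrence of the marker, and the place where
their codes first differ. -/
theorem splitAt_code (hx : x ∈ X) (hx' : x' ∈ X) (h : ∀ i : ℤ, -N ≤ i → i < n → x i = x' i)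
    (hne : x n ≠ x' n) :
    Occurs N w x n ∧ SplitAt (visits N w x n) (code N w x) (code N w x') := by
  obtain ⟨ho, hl⟩ := hX.occurs_of_ne hx hx' (fun i hi hin => h i (by omega) hin) hne
  refine ⟨ho, fun i hi => code_congr h hi, ?_⟩
  have h1 := code_visits ho
  have h2 := code_visits ((occurs_congr h le_rfl).1 ho)
  rw [← visits_congr h] at h2
  intro heq
  rw [heq, h2] at h1
  have := hX.ne
  rcases hl with ⟨e, e'⟩ | ⟨e, e'⟩
  · exact this ((h1.2 e).symm.trans e')
  · exact this ((h1.1 e').symm.trans e)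

theorem exists_of_code_ne [Finite A] (hx : x ∈ X) (ho : Occurs N w x 0)
    (ho' : Occurs N w x' 0) {j : ℕ} (hj : code N w x j ≠ code N w x' j) :
    ∃ n : ℕ, (∀ i : ℤ, -N ≤ i → i < n → x i = x' i) ∧ x n ≠ x' n := by
  have hneg : ∀ i : ℤ, -N ≤ i → i < 0 → x i = x' i := fun i hi hi0 => by
    have h1 := ho i hi hi0
    have h2 := ho' i hi hi0
    simp only [Nat.cast_zero, zero_add] at h1 h2
    rw [h1, h2]
  have hex : ∃ n : ℕ, x n ≠ x' n := by
    by_contra! hall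
    obtain ⟨u, hu, rfl⟩ := exists_visits_eq (hX.infinite_occurs hx) j
    refine hj (code_congr (n := u + 1) (fun i hi _ => ?_) ?_)
    · rcases lt_or_ge i 0 with h | h
      · exact hneg i hi h
      · obtain ⟨k, rfl⟩ := Int.eq_ofNat_of_zero_le h
        exact hall k
    · rw [visits_succ_of_occurs hu]
      omega
  refine ⟨Nat.find hex, fun i hi hin => ?_, Nat.find_spec hex⟩
  rcases lt_or_ge i 0 with h | h
  · exact hneg i hi h
  · obtain ⟨k, rfl⟩ := Int.eq_ofNat_of_zero_le h
    exact not_not.1 (Nat.find_min hex (m := k) (by exact_mod_cast hin))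

theorem exists_of_splitAt_code [Finite A] (hx : x ∈ X) (hx' : x' ∈ X) (ho : Occurs N w x 0)
    (ho' : Occurs N w x' 0) {j : ℕ} (hj : SplitAt j (code N w x) (code N w x')) :
    ∃ n : ℕ, (∀ i : ℤ, -N ≤ i → i < n → x i = x' i) ∧ x n ≠ x' n ∧ visits N w x n = j := by
  obtain ⟨n, hn, hne⟩ := hX.exists_of_code_ne hx ho ho' hj.2
  refine ⟨n, hn, hne, ?_⟩
  have h := (hX.splitAt_code hx hx' hn hne).2
  rcases lt_trichotomy (visits N w x n) j with hlt | heq | hgt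
  · exact absurd (hj.1 _ hlt) h.2
  · exact heq
  · exact absurd (h.1 _ hgt) hj.2

theorem exists_occurs_zero_code_eq [Finite A] (hx : x ∈ X) :
    ∃ y ∈ X, Occurs N w y 0 ∧ code N w y = code N w x := by
  obtain ⟨u, hu, hv⟩ := exists_visits_eq (hX.infinite_occurs hx) 0
  refine ⟨_, hX.shift_mem u x hx, (occurs_shift u 0).2 hu, funext fun j => ?_⟩
  rw [hX.code_shift hx, hv, zero_add]

theorem shift_mem_code [Finite A] :
    ∀ y ∈ code N w '' X, ∀ k, (fun n => y (k + n)) ∈ code N w '' X := by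
  rintro _ ⟨x, hx, rfl⟩ k
  obtain ⟨u, hu, rfl⟩ := exists_visits_eq (hX.infinite_occurs hx) k
  exact ⟨_, hX.shift_mem u x hx, funext fun j => hX.code_shift hx u j⟩

/-- From two occurrences with equal later codes the point continues identically, since a first
difference would show in the codes. -/
theorem code_not_periodic [Finite A] :
    ∀ y ∈ code N w '' X, ∀ i j, i < j → ¬ ∀ n, y (i + n) = y (j + n) := by
  rintro _ ⟨x, hx, rfl⟩ i j hij h
  obtain ⟨a, ha, rfl⟩ := exists_visits_eq (hX.infinite_occurs hx) i
  obtain ⟨b, hb, rfl⟩ := exists_visits_eq (hX.infinite_occurs hx) j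
  have hab : a < b := Nat.lt_of_count_lt_count hij
  refine hX.not_periodic x hx a b hab fun n => ?_
  by_contra hne
  have hex : ∃ n : ℕ, x (a + n) ≠ x (b + n) := ⟨n, hne⟩
  have := (hX.splitAt_code (n := Nat.find hex) (hX.shift_mem a x hx) (hX.shift_mem b x hx)
    (fun i hi hin => by
      simp only [SymbolicDynamics.FullShift.shift_apply]
      rcases lt_or_ge i 0 with h | h
      · rw [ha i hi h, hb i hi h]
      · obtain ⟨k, rfl⟩ := Int.eq_ofNat_of_zero_le h
        exact not_not.1 (Nat.find_min hex (m := k) (by exact_mod_cast hin)))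
    (by simpa using Nat.find_spec hex)).2.2
  rw [hX.code_shift hx, hX.code_shift hx] at this
  exact this (h _)

/-- The words read before the two splits are right special, so by uniqueness the shorter is a suffix
of the longer. The excess `e = t - s` contains no visit, yet `z` starts with one, hence `e = 0`. -/
theorem code_eq_of_le {z z' : ℤ → A} {s t : ℕ} (hx : x ∈ X) (hx' : x' ∈ X) (hz : z ∈ X)
    (hz' : z' ∈ X) (h : ∀ i : ℤ, -N ≤ i → i < s → x i = x' i) (hs : x s ≠ x' s)
    (h' : ∀ i : ℤ, -N ≤ i → i < t → z i = z' i) (ht : z t ≠ z' t) (hst : s ≤ t)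
    (ho : Occurs N w z 0) (hv : visits N w x s = visits N w z t) :
    ∀ i < visits N w x s, code N w x i = code N w z i := by
  obtain ⟨e, rfl⟩ := Nat.exists_eq_add_of_le' hst
  have hag : ∀ i : ℤ, -N ≤ i → i < s → x i = shift (e : ℤ) z i := by
    have := hX.unique (N + s) (by omega) _ (hX.shift_mem s x hx) _ (hX.shift_mem s x' hx')
      _ (hX.shift_mem (e + s : ℕ) z hz) _ (hX.shift_mem (e + s : ℕ) z' hz')
      (fun i hi hi0 => h _ (by push_cast at hi; omega) (by omega)) (by simpa using hs)
      (fun i hi hi0 => h' _ (by push_cast at hi ⊢; omega) (by omega)) (by simpa using ht)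
    simp only [SymbolicDynamics.FullShift.shift_apply] at this ⊢
    intro i hi his
    rcases this with this | this
    · have := (this (i - s) (by push_cast; omega) (by omega)).1
      rw [show (s : ℤ) + (i - s) = i by ring,
        show ((e + s : ℕ) : ℤ) + (i - s) = e + i by push_cast; ring] at this
      exact this.symm
    · have := (this (i - s) (by push_cast; omega) (by omega)).1
      rw [show (s : ℤ) + (i - s) = i by ring,
        show ((e + s : ℕ) : ℤ) + (i - s) = e + i by push_cast; ring] at this
      rw [this, h i hi his]
  have he : e = 0 := by
    rw [visits_add, visits_congr hag] at hv
    have : visits N w z e = 0 := by omega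
    by_contra hpos
    have := Nat.count_iff_forall_not.1 this 0 (by omega)
    exact this ho
  subst he
  simp only [Nat.cast_zero, SymbolicDynamics.FullShift.shift_zero] at hag
  exact fun i hi => code_congr hag hi

/-- Points are first moved to an occurrence at 0 without changing their codes; a split of codes then
comes from a split of points. -/
theorem code_unique [Finite A] : ∀ k, ∀ a ∈ code N w '' X, ∀ a' ∈ code N w '' X,
    ∀ b ∈ code N w '' X, ∀ b' ∈ code N w '' X, SplitAt k a a' → SplitAt k b b' →
      ∀ i < k, a i = b i := by
  have norm : ∀ a ∈ code N w '' X, ∃ x ∈ X, Occurs N w x 0 ∧ code N w x = a := by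
    rintro _ ⟨x, hx, rfl⟩
    exact hX.exists_occurs_zero_code_eq hx
  intro k a ha a' ha' b hb b' hb' hsa hsb
  obtain ⟨x, hx, hox, rfl⟩ := norm a ha
  obtain ⟨x', hx', hox', rfl⟩ := norm a' ha'
  obtain ⟨z, hz, hoz, rfl⟩ := norm b hb
  obtain ⟨z', hz', hoz', rfl⟩ := norm b' hb'
  obtain ⟨s, h1, h2, hs⟩ := hX.exists_of_splitAt_code hx hx' hox hox' hsa
  obtain ⟨t, h3, h4, ht⟩ := hX.exists_of_splitAt_code hz hz' hoz hoz' hsb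
  rcases le_total s t with hst | hst
  · have := hX.code_eq_of_le hx hx' hz hz' h1 h2 h3 h4 hst hoz (by rw [hs, ht])
    rwa [hs] at this
  · have := hX.code_eq_of_le hz hz' hx hx' h3 h4 h1 h2 hst hox (by rw [hs, ht])
    rw [ht] at this
    exact fun i hi => (this i hi).symm

theorem trueCount_code_le [Finite A] (hx : x ∈ X) (hx' : x' ∈ X) (n : ℕ) :
    trueCount (code N w x) n ≤ trueCount (code N w x') n + 1 :=
  trueCount_le_succ hX.shift_mem_code hX.code_unique hX.code_not_periodic n _ ⟨x, hx, rfl⟩ _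
    ⟨x', hx', rfl⟩

omit hX in
theorem letterVisits_eq (n : ℕ) :
    letterVisits N w x n = trueCount (code N w x) (visits N w x n) := by
  induction n with
  | zero => simp [letterVisits, visits, trueCount]
  | succ n ih =>
    by_cases ho : Occurs N w x n
    · rw [visits_succ_of_occurs ho, trueCount_succ, ← ih, letterVisits, Nat.count_succ]
      have := code_visits ho
      by_cases hl : x n = w 0
      · simp [letterVisits, ho, hl, this.2 hl]
      · have h2 : code N w x (visits N w x n) = false := by simpa using mt this.1 hl
        simp [letterVisits, hl, h2]
    · rw [visits_succ_of_not_occurs ho, ← ih]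
      simp [letterVisits, Nat.count_succ, ho]

theorem exists_occurs_letter [Finite A] (hx : x ∈ X) : ∃ u, Occurs N w x u ∧ x u = w 0 := by
  by_contra! hcon
  have hc : ∀ j, code N w x j = false := by
    intro j
    obtain ⟨u, hu, rfl⟩ := exists_visits_eq (hX.infinite_occurs hx) j
    simpa using mt (code_visits hu).1 (hcon u hu)
  exact hX.code_not_periodic _ ⟨x, hx, rfl⟩ 0 1 one_pos fun n => by rw [hc, hc]

theorem exists_occurs_letter' [Finite A] (hx : x ∈ X) : ∃ u, Occurs N w x u ∧ x u = w' 0 := by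
  by_contra! hcon
  have hc : ∀ j, code N w x j = true := by
    intro j
    obtain ⟨u, hu, rfl⟩ := exists_visits_eq (hX.infinite_occurs hx) j
    rw [code_visits hu]
    by_contra hne
    exact hcon u hu (hX.letter_of_occurs hx hu hne)
  exact hX.code_not_periodic _ ⟨x, hx, rfl⟩ 0 1 one_pos fun n => by rw [hc, hc]

omit hX in
theorem exists_first_occurs (hex : ∃ u, Occurs N w x u) :
    Occurs N w x (sInf {u | Occurs N w x u}) := Nat.sInf_mem hex

/-- The time to the next occurrence after an occurrence of the marker depends only on the letter
that follows it. -/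
theorem sInf_occurs_shift_le [Finite A] (hx : x ∈ X) (hx' : x' ∈ X) (ho : Occurs N w x 0)
    (ho' : Occurs N w x' 0) (h0 : x 0 = x' 0) :
    sInf {u | Occurs N w (shift (1 : ℤ) x') u} ≤ sInf {u | Occurs N w (shift (1 : ℤ) x) u} := by
  set r := sInf {u | Occurs N w (shift (1 : ℤ) x) u} with hr
  have hor : Occurs N w (shift (1 : ℤ) x) r :=
    Nat.sInf_mem (hX.infinite_occurs (hX.shift_mem 1 x hx)).nonempty
  by_contra! hlt
  have hno : ¬ Occurs N w (shift (1 : ℤ) x') r := fun h => absurd (Nat.sInf_le h) (by simpa using hlt)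
  have key : ∀ m : ℕ, m ≤ r + 1 → ∀ i : ℤ, -N ≤ i → i < m → x i = x' i := by
    intro m
    induction m with
    | zero =>
      intro _ i hi hi0
      have h1 := ho i hi (by simpa using hi0)
      have h2 := ho' i hi (by simpa using hi0)
      simp only [Nat.cast_zero, zero_add] at h1 h2
      rw [h1, h2]
    | succ m ih =>
      intro hm i hi him
      rcases lt_or_ge i (m : ℤ) with h | h
      · exact ih (by omega) i hi h
      · obtain rfl : i = m := by push_cast at him; omega
        by_contra hne
        have hom := (hX.splitAt_code hx hx' (ih (by omega)) hne).1
        rcases m with _ | m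
        · exact hne (by simpa using h0)
        · have : r ≤ m := Nat.sInf_le (by
            have := (occurs_shift (N := N) (w := w) (x := x) 1 m).2 (by rwa [add_comm])
            simpa using this)
          omega
  refine hno ?_
  have h1 := (occurs_shift (N := N) (w := w) (x := x) 1 r).1 (by simpa using hor)
  have h2 := (occurs_congr (key (r + 1) le_rfl) (by omega : 1 + r ≤ r + 1)).1 h1
  simpa using (occurs_shift (N := N) (w := w) (x := x') 1 r).2 h2

/-- The time elapsed is, up to the waiting times at both ends, a linear combination of the numbers
of the two kinds of occurrences of the marker. -/
theorem exists_linear [Finite A] : ∃ h k : ℕ, 0 < h ∧ 0 < k ∧ ∀ x ∈ X, ∀ n : ℕ,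
    (n + sInf {u | Occurs N w (shift (n : ℤ) x) u} : ℤ) = sInf {u | Occurs N w x u} +
      h * letterVisits N w x n + k * (visits N w x n - letterVisits N w x n) := by
  -- The coefficients are the return times to the marker after the letters `w 0` and `w' 0`.
  refine ⟨sInf {u | Occurs N w (shift (1 : ℤ) w) u} + 1,
    sInf {u | Occurs N w (shift (1 : ℤ) w') u} + 1, by omega, by omega, fun x hx n => ?_⟩
  induction n with
  | zero => simp [letterVisits, visits]
  | succ n ih =>
    set y := shift (n : ℤ) x with hy
    have hyX : y ∈ X := hX.shift_mem n x hx
    have hsh : shift ((n + 1 : ℕ) : ℤ) x = shift (1 : ℤ) y := by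
      rw [hy, ← SymbolicDynamics.FullShift.shift_add]
      simp
    have hoy : Occurs N w y 0 ↔ Occurs N w x n := occurs_shift n 0
    have hy0 : y 0 = x n := by simp [hy]
    have how : Occurs N w w 0 := fun i _ _ => by simp
    have how' : Occurs N w w' 0 := fun i hi hi0 => by simpa using (hX.agree i hi hi0).symm
    rw [hsh]
    by_cases ho : Occurs N w x n
    · have h0 : sInf {u | Occurs N w y u} = 0 := Nat.sInf_eq_zero.2 (Or.inl (hoy.2 ho))
      rw [visits_succ_of_occurs ho]
      rw [h0] at ih
      by_cases hl : x n = w 0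
      · have h1 : letterVisits N w x (n + 1) = letterVisits N w x n + 1 := by
          simp [letterVisits, Nat.count_succ, ho, hl]
        have h2 := le_antisymm (hX.sInf_occurs_shift_le hX.mem hyX how (hoy.2 ho) (by rw [hy0, hl]))
          (hX.sInf_occurs_shift_le hyX hX.mem (hoy.2 ho) how (by rw [hy0, hl]))
        rw [h1, h2]
        push_cast at ih ⊢
        linarith
      · have h1 : letterVisits N w x (n + 1) = letterVisits N w x n := by
          simp [letterVisits, Nat.count_succ, hl]
        have hl' := hX.letter_of_occurs hx ho hl
        have h2 := le_antisymm
          (hX.sInf_occurs_shift_le hX.mem' hyX how' (hoy.2 ho) (by rw [hy0, hl']))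
          (hX.sInf_occurs_shift_le hyX hX.mem' (hoy.2 ho) how' (by rw [hy0, hl']))
        rw [h1, h2]
        push_cast at ih ⊢
        linarith
    · have h1 : letterVisits N w x (n + 1) = letterVisits N w x n := by
        simp [letterVisits, Nat.count_succ, ho]
      have h2 : sInf {u | Occurs N w y u} = sInf {u | Occurs N w (shift (1 : ℤ) y) u} + 1 := by
        have hm : 0 < sInf {u | Occurs N w y u} := by
          refine Nat.pos_of_ne_zero fun h => ?_
          have := exists_first_occurs (hX.infinite_occurs hyX).nonempty
          rw [h] at this
          exact ho (hoy.1 this)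
        rw [← Nat.sInf_add (n := 1) (p := fun u => Occurs N w y u) hm]
        simp only [← Nat.cast_one (R := ℤ), occurs_shift, add_comm 1]
      rw [visits_succ_of_not_occurs ho, h1]
      rw [h2] at ih
      push_cast at ih ⊢
      linarith

/-- The occurrences of the marker followed by a given letter have bounded discrepancy. -/
theorem exists_letterVisits_le [Finite A] : ∃ C : ℕ, ∀ x ∈ X, ∀ x' ∈ X, ∀ n : ℕ,
    letterVisits N w x n ≤ letterVisits N w x' n + C := by
  obtain ⟨h, k, hh, hk, hlin⟩ := hX.exists_linear
  obtain ⟨K, hK⟩ := hX.exists_occurs_le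
  have hle : ∀ x ∈ X, sInf {u | Occurs N w x u} ≤ K := fun x hx => by
    obtain ⟨u, hu, ho⟩ := hK x hx
    exact (Nat.sInf_le ho).trans hu
  refine ⟨2 * K + k + 1, fun x hx x' hx' n => ?_⟩
  have e1 := hlin x hx n
  have e2 := hlin x' hx' n
  have b1 := hle x hx
  have b2 := hle x' hx'
  have b3 := hle _ (hX.shift_mem n x hx)
  have b4 := hle _ (hX.shift_mem n x' hx')
  rw [letterVisits_eq] at e1 e2
  rw [letterVisits_eq, letterVisits_eq]
  have hmono : ∀ y : ℕ → Bool, ∀ {a b : ℕ}, a ≤ b →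
      trueCount y a ≤ trueCount y b ∧ trueCount y b ≤ trueCount y a + (b - a) := by
    intro y a b hab
    obtain ⟨c, rfl⟩ := Nat.exists_eq_add_of_le hab
    rw [trueCount_add]
    have := trueCount_le (fun i => y (a + i)) c
    omega
  set m := visits N w x n
  set m' := visits N w x' n
  rcases le_total m m' with hmm | hmm
  · have h1 := hX.trueCount_code_le hx hx' m
    have h2 := hmono (code N w x') hmm
    omega
  · have h1 := hX.trueCount_code_le hx hx' m'
    have h2 := hmono (code N w x) hmm
    set c := trueCount (code N w x) m
    set c' := trueCount (code N w x') m'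
    by_contra! hcon
    -- By balance, the orbit with more visits has, up to one, at least as many of the other letter.
    -- A large excess of `w 0` could therefore not be offset in the elapsed time, which agrees up to
    -- `2 * K`.
    have hd : (m' : ℤ) - c' ≤ m - c + 1 := by omega
    have hc : (2 * K + k + 1 : ℤ) < c - c' := by omega
    have hA : (k : ℤ) * (m' - c') ≤ k * (m - c + 1) := by gcongr
    have hB : (c - c' : ℤ) ≤ h * (c - c') := by nlinarith
    have hsub : (h : ℤ) * c + k * (m - c) - (h * c' + k * (m' - c')) ≤ 2 * K := by
      have := Int.natCast_nonneg (sInf {u | Occurs N w (shift (n : ℤ) x') u})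
      have := Int.natCast_nonneg (sInf {u | Occurs N w x u})
      omega
    nlinarith

end IsMarker

end Coding

/-! ### Weak mixing against bounded discrepancy -/

/-- A set on which the Birkhoff sums of a weakly mixing transformation have bounded discrepancy
is null or conull: the discrepancy is a coboundary, which gives an eigenvalue. -/
theorem IsWeaklyMixing.measureReal_eq_zero_or_one {Ω : Type*} [MeasurableSpace Ω] {T : Ω → Ω}
    {μ : Measure Ω} [IsProbabilityMeasure μ] (h : IsWeaklyMixing T μ) {B S : Set Ω}
    (hB : MeasurableSet B) (hS : ∀ᵐ x ∂μ, x ∈ S) (hTS : ∀ x ∈ S, T x ∈ S) {C : ℝ}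
    (hC : ∀ x ∈ S, ∀ x' ∈ S, ∀ n, birkhoffSum T (B.indicator (1 : Ω → ℝ)) n x ≤
      birkhoffSum T (B.indicator (1 : Ω → ℝ)) n x' + C) :
    μ.real B = 0 ∨ μ.real B = 1 := by
  obtain ⟨hT, hE⟩ := h
  set f : Ω → ℝ := B.indicator 1 with hf
  set α : ℝ := μ.real B
  have hfm : Measurable f := measurable_one.indicator hB
  have hf01 : ∀ x, ∃ k : ℤ, f x = k := fun x => by
    by_cases hx : x ∈ B
    · exact ⟨1, by simp [hf, hx]⟩
    · exact ⟨0, by simp [hf, hx]⟩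
  have hfi : ∀ k, Integrable (fun x => f (T^[k] x)) μ := fun k =>
    (hT.iterate k).integrable_comp_of_integrable ((integrable_const (1 : ℝ)).indicator hB)
  have hbm : ∀ n, Measurable (birkhoffSum T f n) := fun n => by
    unfold birkhoffSum
    exact Finset.measurable_fun_sum _ fun k _ => hfm.comp (hT.iterate k).measurable
  have hbi : ∀ n, Integrable (birkhoffSum T f n) μ := fun n =>
    integrable_finsetSum _ fun k _ => hfi k
  have hint : ∀ n, ∫ x, birkhoffSum T f n x ∂μ = n * α := fun n => by
    unfold birkhoffSum
    rw [integral_finsetSum _ fun k _ => hfi k]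
    have : ∀ k, ∫ x, f (T^[k] x) ∂μ = α := fun k => by
      rw [← integral_map (hT.iterate k).aemeasurable (by fun_prop), (hT.iterate k).map_eq]
      exact integral_indicator_one hB
    simp [this]
  -- Integrating the discrepancy bound over the other point replaces its Birkhoff sum by the mean `n
  -- * α`.
  have hup : ∀ x ∈ S, ∀ n, birkhoffSum T f n x - n * α ≤ C := fun x hx n => by
    have := integral_mono_ae (integrable_const (birkhoffSum T f n x))
      ((hbi n).add (integrable_const C)) (hS.mono fun y hy => hC x hx y hy n)
    simp only [Pi.add_apply] at this
    rw [integral_add (hbi n) (integrable_const C), hint] at this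
    simp at this
    linarith
  have hlo : ∀ x ∈ S, ∀ n, -C ≤ birkhoffSum T f n x - n * α := fun x hx n => by
    have := integral_mono_ae (hbi n) (integrable_const (birkhoffSum T f n x + C))
      (hS.mono fun y hy => hC y hy x hx n)
    rw [hint] at this
    simp at this
    linarith
  set g : Ω → ℝ := fun x => limsup (fun n : ℕ => birkhoffSum T f n x - n * α) atTop with hg
  have hgm : Measurable g := Measurable.limsup fun n => (hbm n).sub_const _
  have hgT : ∀ x ∈ S, g (T x) = g x - f x + α := fun x hx => by
    have h1 : g x = limsup (fun n : ℕ => birkhoffSum T f n (T x) - n * α + (f x - α)) atTop := by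
      rw [hg]
      simp only
      rw [← limsup_nat_add _ 1]
      congr 1
      funext n
      rw [birkhoffSum_succ']
      push_cast
      ring
    have h2 : IsBoundedUnder (· ≤ ·) atTop
        (fun n : ℕ => birkhoffSum T f n (T x) - n * α) :=
      isBoundedUnder_of ⟨C, fun n => hup _ (hTS x hx) n⟩
    have h3 : IsCoboundedUnder (· ≤ ·) atTop
        (fun n : ℕ => birkhoffSum T f n (T x) - n * α) :=
      IsBoundedUnder.isCoboundedUnder_le (isBoundedUnder_of ⟨-C, fun n => hlo _ (hTS x hx) n⟩)
    rw [limsup_add_const _ _ _ h2 h3] at h1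
    linarith
  -- In `g z.1 - g z.2` the constant `α` cancels and `f` takes integer values, so the fractional
  -- part is invariant.
  have hinv : (fun z : Ω × Ω => Int.fract (g z.1 - g z.2)) ∘ Prod.map T T =ᵐ[μ.prod μ]
      fun z => Int.fract (g z.1 - g z.2) := by
    filter_upwards [Measure.quasiMeasurePreserving_fst.ae hS,
      Measure.quasiMeasurePreserving_snd.ae hS] with z h1 h2
    obtain ⟨k, hk⟩ := hf01 z.1
    obtain ⟨l, hl⟩ := hf01 z.2
    refine Int.fract_eq_fract.2 ⟨l - k, ?_⟩
    simp only [Prod.map_fst, Prod.map_snd, hgT _ h1, hgT _ h2, hk, hl]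
    push_cast
    ring
  obtain ⟨c, hc⟩ := hE.ae_eq_const_of_ae_eq_comp₀
    (measurable_fract.comp ((hgm.comp measurable_fst).sub
      (hgm.comp measurable_snd))).nullMeasurable hinv
  obtain ⟨x, hx⟩ := (Measure.ae_ae_of_ae_prod hc).exists
  obtain ⟨y, hy, hTy, hyS⟩ := (hx.and ((hT.quasiMeasurePreserving.ae hx).and hS)).exists
  simp only [Function.const_apply] at hy hTy
  -- Comparing the pairs `(x, y)` and `(x, T y)` shows that `g (T y) - g y`, hence `α`, is an
  -- integer.
  obtain ⟨k, hk⟩ := Int.fract_eq_fract.1 (hy.trans hTy.symm)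
  obtain ⟨l, hl⟩ := hf01 y
  simp only [Pi.sub_apply, Function.comp_apply, hgT y hyS, hl] at hk
  have hα : α = ((k + l : ℤ) : ℝ) := by
    push_cast
    linarith
  have h0 : (0 : ℝ) ≤ α := measureReal_nonneg
  have h1 : α ≤ 1 := measureReal_le_one
  rw [hα] at h0 h1 ⊢
  norm_cast at h0 h1 ⊢
  omega

theorem iterate_shift_one {A : Type*} (u : ℕ) (x : ℤ → A) :
    (shift (1 : ℤ))^[u] x = shift (u : ℤ) x := by
  induction u with
  | zero => simp
  | succ u ih =>
    rw [Function.iterate_succ_apply', ih, ← SymbolicDynamics.FullShift.shift_add]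
    simp

theorem shift_mem_cylinder {A : Type*} {N : ℕ} {w x : ℤ → A} {u : ℕ} :
    shift (u : ℤ) x ∈ cylinder (Finset.Icc (-N : ℤ) 0) w ↔ Occurs N w x u ∧ x u = w 0 := by
  simp only [SymbolicDynamics.FullShift.mem_cylinder, Finset.mem_Icc,
    SymbolicDynamics.FullShift.shift_apply]
  constructor
  · exact fun h => ⟨fun i hi hi0 => h i ⟨hi, hi0.le⟩, by simpa using h 0 (by simp)⟩
  · rintro ⟨h, h0⟩ i ⟨hi, hi0⟩
    rcases hi0.lt_or_eq with hlt | rfl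
    · exact h i hi hlt
    · simpa using h0

theorem measurableSet_cylinder {A : Type*} [MeasurableSpace A] [DiscreteMeasurableSpace A]
    (U : Finset ℤ) (w : ℤ → A) : MeasurableSet (cylinder U w) := by
  rw [SymbolicDynamics.FullShift.cylinder_eq_set_pi]
  exact MeasurableSet.pi U.countable_toSet fun _ _ => MeasurableSet.of_discrete

theorem birkhoffSum_cylinder {A : Type*} (N : ℕ) (w x : ℤ → A) (n : ℕ) :
    birkhoffSum (shift (1 : ℤ))
      ((cylinder (Finset.Icc (-N : ℤ) 0) w).indicator (1 : (ℤ → A) → ℝ)) n x =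
      letterVisits N w x n := by
  classical
  rw [letterVisits, Nat.count_eq_card_filter_range, Finset.card_filter]
  push_cast
  refine Finset.sum_congr rfl fun u _ => ?_
  rw [iterate_shift_one, Set.indicator_apply]
  simp [shift_mem_cylinder]

/-- A set that almost every point visits is not null. -/
theorem measure_ne_zero_of_exists_iterate_mem {Ω : Type*} [MeasurableSpace Ω] {T : Ω → Ω}
    {μ : Measure Ω} [NeZero μ] (hT : MeasurePreserving T μ μ) {B : Set Ω}
    (h : ∀ᵐ x ∂μ, ∃ u, T^[u] x ∈ B) : μ B ≠ 0 := by
  intro h0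
  have h1 : ∀ᵐ x ∂μ, ∀ u, T^[u] x ∉ B :=
    ae_all_iff.2 fun u => (hT.iterate u).quasiMeasurePreserving.ae (measure_eq_zero_iff_ae_notMem.1 h0)
  obtain ⟨x, ⟨u, hu⟩, hx⟩ := (h.and h1).exists
  exact hx u hu

theorem IsMarker.not_admitsWeaklyMixingMeasure {A : Type*} [Finite A] [MeasurableSpace A]
    [DiscreteMeasurableSpace A] {X : Set (ℤ → A)} {N : ℕ} {w w' : ℤ → A}
    (hX : IsMarker X N w w') : ¬ AdmitsWeaklyMixingMeasure X := by
  rintro ⟨μ, hμ, hμX, hwm⟩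
  have hae : ∀ᵐ x ∂μ, x ∈ X := hμX
  have hB := measurableSet_cylinder (Finset.Icc (-N : ℤ) 0) w
  obtain ⟨C, hC⟩ := hX.exists_letterVisits_le
  rcases hwm.measureReal_eq_zero_or_one hB hae (hX.shift_mem 1) (C := C)
    (fun x hx x' hx' n => by
      rw [birkhoffSum_cylinder, birkhoffSum_cylinder]
      exact_mod_cast hC x hx x' hx' n) with h | h
  · refine measure_ne_zero_of_exists_iterate_mem hwm.1 (hae.mono fun x hx => ?_)
      ((measureReal_eq_zero_iff).1 h)
    obtain ⟨u, hu⟩ := hX.exists_occurs_letter hx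
    exact ⟨u, by rw [iterate_shift_one]; exact shift_mem_cylinder.2 hu⟩
  · have h0 : μ (cylinder (Finset.Icc (-N : ℤ) 0) w)ᶜ = 0 := by
      rw [prob_compl_eq_zero_iff hB]
      simpa [measureReal_def, ENNReal.toReal_eq_one_iff] using h
    refine measure_ne_zero_of_exists_iterate_mem hwm.1 (hae.mono fun x hx => ?_) h0
    obtain ⟨u, hu, hl⟩ := hX.exists_occurs_letter' hx
    refine ⟨u, fun hmem => hX.ne ?_⟩
    rw [iterate_shift_one] at hmem
    exact (shift_mem_cylinder.1 hmem).2.symm.trans hl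

/-! ### Existence of a marker and the main theorem -/

/-- If the complexity of an aperiodic subshift eventually grows by one at each step, then the
subshift has a marker. -/
theorem exists_isMarker {A : Type*} [Finite A] {X : Set (ℤ → A)}
    (hT : ∀ k : ℤ, ∀ x ∈ X, shift k x ∈ X)
    (hP : ∀ x ∈ X, ∀ i j : ℕ, i < j → ¬ ∀ n : ℕ, x (i + n) = x (j + n)) (hne : X.Nonempty) {N : ℕ}
    (hN : ∀ q, N ≤ q → complexity X (q + 1) ≤ complexity X q + 1) :
    ∃ w w', IsMarker X N w w' := by
  have hlt := complexity_lt_complexity_succ hne hT hP N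
  have hex : ∃ w ∈ X, ∃ w' ∈ X, (∀ i : ℤ, -N ≤ i → i < 0 → w i = w' i) ∧ w 0 ≠ w' 0 := by
    by_contra! hcon
    unfold complexity at hlt
    rw [language_eq_image_succ hT N, language_eq_image hT, Set.InjOn.ncard_image] at hlt
    · omega
    · rintro _ ⟨x, hx, rfl⟩ _ ⟨y, hy, rfl⟩ heq
      have hag : ∀ i : ℕ, i < N → x i = y i := fun i hi => congrFun heq ⟨i, hi⟩
      have := hcon _ (hT N x hx) _ (hT N y hy) (fun i hi hi0 => by
        obtain ⟨k, hk⟩ := Int.eq_ofNat_of_zero_le (show 0 ≤ N + i by omega)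
        simp only [SymbolicDynamics.FullShift.shift_apply]
        rw [hk]
        exact hag k (by omega))
      funext i
      rcases Nat.lt_or_ge i N with hi | hi
      · exact hag i hi
      · have hiN : (i : ℕ) = N := by omega
        simpa [hiN] using this
  obtain ⟨w, hw, w', hw', hag, hne0⟩ := hex
  exact ⟨w, w', hw, hw', hT, hP, hag, hne0, fun q hq x hx y hy x' hx' y' hy' h h0 h' h0' =>
    eq_or_eq_of_complexity_succ_le hT (hN q hq) hx hy hx' hy' h h0 h' h0'⟩

end WordComplexity

theorem proposition1p1 {A : Type*} [Finite A] [TopologicalSpace A] [DiscreteTopology A]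
    [MeasurableSpace A] [DiscreteMeasurableSpace A]
    (X : SymbolicDynamics.FullShift.Subshift A ℤ) (hne : X.carrier.Nonempty)
    (hap : WordComplexity.IsAperiodic X.carrier) :
    (∀ d : ℤ, {q : ℕ | (WordComplexity.complexity X.carrier q : ℤ) ≤ q + d}.Infinite →
      (∃ c : ℤ, ∀ᶠ q : ℕ in atTop, (WordComplexity.complexity X.carrier q : ℤ) = q + c) ∧
      (∀ x ∈ X.carrier, WordComplexity.IsQuasiSturmian x) ∧
      ¬ WordComplexity.AdmitsWeaklyMixingMeasure X.carrier) ∧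
    (WordComplexity.AdmitsWeaklyMixingMeasure X.carrier →
      Tendsto (fun q : ℕ => (WordComplexity.complexity X.carrier q : ℤ) - q) atTop atTop) := by
  have hT : ∀ k : ℤ, ∀ x ∈ X.carrier, SymbolicDynamics.FullShift.shift k x ∈ X.carrier :=
    fun k x hx => X.mapsTo k hx
  have hP : ∀ x ∈ X.carrier, ∀ i j : ℕ, i < j → ¬ ∀ n : ℕ, x (i + n) = x (j + n) :=
    fun x hx i j hij => hap.not_eventually_periodic hx hij
  have main : ∀ d : ℤ, {q : ℕ | (WordComplexity.complexity X.carrier q : ℤ) ≤ q + d}.Infinite →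
      (∃ c : ℤ, ∀ᶠ q : ℕ in atTop, (WordComplexity.complexity X.carrier q : ℤ) = q + c) ∧
      (∀ x ∈ X.carrier, WordComplexity.IsQuasiSturmian x) ∧
      ¬ WordComplexity.AdmitsWeaklyMixingMeasure X.carrier := by
    intro d hd
    have hev := WordComplexity.eventually_eq_add_of_infinite
      (WordComplexity.complexity_lt_complexity_succ hne hT hP) hd
    refine ⟨hev, fun x hx => ?_, ?_⟩
    · refine WordComplexity.eventually_eq_add_of_infinite (d := d)
        (p := WordComplexity.wordComplexity x) (fun q => ?_) (hd.mono fun q hq => ?_)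
      -- The orbit need not be closed: strict growth only uses invariance and the absence of
      -- eventually periodic points.
      · rw [← WordComplexity.complexity_range_shift, ← WordComplexity.complexity_range_shift]
        refine WordComplexity.complexity_lt_complexity_succ (Set.range_nonempty _) ?_ ?_ q
        · rintro k _ ⟨l, rfl⟩
          exact ⟨l + k, SymbolicDynamics.FullShift.shift_add l k x⟩
        · rintro _ ⟨l, rfl⟩
          exact hP _ (hT l x hx)
      · have := WordComplexity.wordComplexity_le_complexity hx q
        simp only [Set.mem_ofPred_eq] at hq ⊢
        omega
    · obtain ⟨c, hc⟩ := hev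
      obtain ⟨N, hN⟩ := eventually_atTop.1 hc
      obtain ⟨w, w', hX⟩ := WordComplexity.exists_isMarker hT hP hne (N := N) fun q hq => by
        have h1 := hN q hq
        have h2 := hN (q + 1) (by omega)
        push_cast at h2
        omega
      exact hX.not_admitsWeaklyMixingMeasure
  refine ⟨main, fun hwm => tendsto_atTop.2 fun b => ?_⟩
  have hfin : {q : ℕ | (WordComplexity.complexity X.carrier q : ℤ) ≤ q + b}.Finite := by
    by_contra hinf
    exact (main b hinf).2.2 hwm
  rw [← Nat.cofinite_eq_atTop]
  filter_upwards [hfin.compl_mem_cofinite] with q hq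
  simp only [Set.mem_compl_iff, Set.mem_ofPred_eq, not_le] at hq
  omega
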